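/- **Setting.** Let $V$ be a finite set of qubits. A *stabilizer graph* $G$ on $V$ is a simple undirected graph with node set $V$ together with three arbitrary subsets of $V$: the set of nodes with a (self) loop, the set $\mathcal H$ of *hollow* nodes (all others are *solid*), and the set $\mathcal Z$ of nodes with a (minus) *sign*. $\mathcal N(j)$ denotes the set of neighbors of $j$; a node is never its own neighbor, even if it has a loop. The graph represents the state $|\psi_G\rangle$ obtained from $|0\rangle^{\otimes V}$ by applying the Hadamard gate $H=\frac1{\sqrt2}\begin{pmatrix}1&1\\1&-1\end{pmatrix}$ to every qubit, then a controlled-$Z$ gate along every edge, and then, at each node, $Z$ if it has a sign, followed by $S=\mathrm{diag}(1,i)$ if it has a loop, followed by $H$ if it is hollow. Let $M=\bigotimes_{j\in V}M_j$ with every $M_j\in\{I,Z\}$ (a *$Z$-type Pauli-product measurement*), and let $\mathcal M=\{j: M_j\neq I\}$ be the set of measured nodes, $\mathcal M_S=\mathcal M\setminus\mathcal H$, $\mathcal M_H=\mathcal M\cap\mathcal H$, $$\mathcal M_{SE}=\{j\in\mathcal M_S : |\mathcal M_H\cap\mathcal N(j)|\text{ is even}\},\qquad b=|\mathcal M_H\cap\mathcal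 Z|.$$ For $m\in\{0,1\}$ put $P_m=\frac12(I+(-1)^mM)$; measuring $M$ on $|\psi\rangle$ gives the outcome $(-1)^m$ with probability $\langle\psi|P_m|\psi\rangle$, and then the post-measurement state is $P_m|\psi\rangle/\sqrt{\langle\psi|P_m|\psi\rangle}$. **Theorem.** Suppose that the measured hollow nodes of $G$ have no loops and are connected neither to one another nor to unmeasured nodes, and let $M$ be measured on $|\psi\rangle=|\psi_G\rangle$. (a) The outcome is $(-1)^b$ with probability $1$ if and only if $\mathcal M_{SE}=\varnothing$; in that case the outcome $(-1)^{b+1}$ has probability $0$ and the state is unchanged by the measurement. (b) If $\mathcal M_{SE}\ne\varnothing$, then each of the two outcomes has probability $\frac12$. Moreover, for each outcome $(-1)^m$ and for every node $p\in\mathcal M_{SE}$ (the *chosen* node), the post-measurement state is represented, up to a global phase, by the stabilizer graph obtained from $G$ by performing the following steps in order, where $\mathcal M_{SE}$ and $b$ are always those of the original graph: 1. For each neighbor of $p$, complement all of its edges to the nodes of $\mathcal M_{SE}\setminus\{p\}$ (other than itself), i.e. remove the edge if it is present and add it otherwise; an edge reached from both of its ends is complemented twice. 2. If $p$ has no sign,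 flip the signs of all neighbors of $p$ that are in $\mathcal M_{SE}$; if $p$ has a sign, remove that sign and flip the signs of all nodes of $\mathcal M_{SE}\setminus\{p\}$ that are not neighbors of $p$. Then, if $m\not\equiv b\pmod 2$, flip the signs of $p$ and of all its neighbors. 3. Remove all edges at $p$, then connect $p$ to all nodes of $\mathcal M_{SE}\setminus\{p\}$, and make $p$ hollow. 4. If $p$ has a loop: remove that loop; complement all edges between neighbors of $p$; *advance* the loop of every neighbor of $p$ (if the neighbor has no loop, add one; if it has one, remove it and flip the sign of the neighbor); and, if $m\not\equiv b\pmod 2$, flip the signs of all nodes of $\mathcal M_{SE}\setminus\{p\}$. -/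

import Mathlib

open scoped Matrix symmDiff

/-! ## Qubits labelled by `V`: states are vectors indexed by bit assignments `V → Fin 2` -/

/-- Pure (not necessarily normalized) state vectors of qubits labelled by `V`, written in the
standard basis `|x⟩`, `x : V → Fin 2`. -/
abbrev QState (V : Type*) := (V → Fin 2) → ℂ

/-- Operators on the qubits labelled by `V`, as matrices in the standard basis. -/
abbrev QOp (V : Type*) := Matrix (V → Fin 2) (V → Fin 2) ℂ

/-- The tensor product `⨂ j, A j` of one-qubit operators. -/
def tensorOp {V : Type*} [Fintype V] (A : V → Matrix (Fin 2) (Fin 2) ℂ) : QOp V :=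
  Matrix.of fun x y => ∏ j, A j (x j) (y j)

/-- The state `|0⟩ ⊗ ⋯ ⊗ |0⟩`. -/
def zeroState (V : Type*) [Fintype V] : QState V :=
  Pi.single (fun _ => 0) 1

namespace Gate

/-- Pauli `X`. -/
def X : Matrix (Fin 2) (Fin 2) ℂ := !![0, 1; 1, 0]

/-- Pauli `Y`. -/
def Y : Matrix (Fin 2) (Fin 2) ℂ := !![0, -Complex.I; Complex.I, 0]

/-- Pauli `Z`. -/
def Z : Matrix (Fin 2) (Fin 2) ℂ := !![1, 0; 0, -1]

/-- The phase gate `S`. -/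
def S : Matrix (Fin 2) (Fin 2) ℂ := !![1, 0; 0, Complex.I]

/-- The Hadamard gate `H`. -/
noncomputable def H : Matrix (Fin 2) (Fin 2) ℂ :=
  ((1 / Real.sqrt 2 : ℝ) : ℂ) • !![1, 1; 1, -1]

/-- The controlled-`Z` gate between the qubits `j` and `k`: it multiplies `|x⟩` by `-1` exactly
when both `x j` and `x k` are `1`. -/
def CZ {V : Type*} [Fintype V] [DecidableEq V] (j k : V) : QOp V :=
  Matrix.diagonal fun x => if x j = 1 ∧ x k = 1 then -1 else 1

theorem CZ_symm {V : Type*} [Fintype V] [DecidableEq V] (j k : V) :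
    (CZ j k : QOp V) = CZ k j := by
  simp only [CZ, and_comm]

/-- The controlled-`Z` gate along an unordered pair. -/
def CZedge {V : Type*} [Fintype V] [DecidableEq V] (e : Sym2 V) : QOp V :=
  Sym2.lift ⟨CZ, CZ_symm⟩ e

theorem CZedge_commute {V : Type*} [Fintype V] [DecidableEq V] (e f : Sym2 V) :
    Commute (CZedge e : QOp V) (CZedge f) := by
  induction e with
  | _ a b =>
    induction f with
    | _ c d => exact Matrix.commute_diagonal _ _

end Gate

/-! ## Projective measurements -/

/-- The projector `P_m = (I + (-1)^m A) / 2` onto the outcome `(-1)^m` of a measurement of an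
observable `A` with `A² = I`. Only the parity of `m` matters. -/
noncomputable def outcomeProj {V : Type*} [DecidableEq V] [Fintype V] (A : QOp V) (m : ℕ) :
    QOp V :=
  (1 / 2 : ℂ) • (1 + (-1 : ℂ) ^ m • A)

/-- The probability `⟨ψ|P_m|ψ⟩` of the outcome `(-1)^m` (a real number, as `P_m` is Hermitian). -/
noncomputable def outcomeProb {V : Type*} [DecidableEq V] [Fintype V] (A : QOp V) (ψ : QState V)
    (m : ℕ) : ℝ :=
  (star ψ ⬝ᵥ (outcomeProj A m *ᵥ ψ)).re

/-- The post-measurement state `P_m|ψ⟩ / √⟨ψ|P_m|ψ⟩` after the outcome `(-1)^m`. -/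
noncomputable def postState {V : Type*} [DecidableEq V] [Fintype V] (A : QOp V) (ψ : QState V)
    (m : ℕ) : QState V :=
  (((Real.sqrt (outcomeProb A ψ m))⁻¹ : ℝ) : ℂ) • (outcomeProj A m *ᵥ ψ)

/-- Two vectors describe the same physical state: they differ by a global phase. -/
def SameState {V : Type*} (φ ψ : QState V) : Prop :=
  ∃ c : ℂ, ‖c‖ = 1 ∧ φ = c • ψ

/-! ## Pauli products -/

/-- Labels of the one-qubit Pauli operators. -/
inductive Pauli
  | I
  | X
  | Y
  | Z
  deriving DecidableEq

/-- The matrix of a Pauli label. -/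
def Pauli.toMatrix : Pauli → Matrix (Fin 2) (Fin 2) ℂ
  | .I => 1
  | .X => Gate.X
  | .Y => Gate.Y
  | .Z => Gate.Z

/-- A Pauli-product measurement `M = ⨂ j, M j`, given by its tensor factors. -/
abbrev PauliProduct (V : Type*) := V → Pauli

namespace PauliProduct

variable {V : Type*} [Fintype V] [DecidableEq V]

/-- The observable `⨂ j, M j`. -/
def toOp (M : PauliProduct V) : QOp V := tensorOp fun j => (M j).toMatrix

/-- The measurement is of `Z` type: every tensor factor is `I` or `Z`. -/
def IsZType (M : PauliProduct V) : Prop := ∀ j, M j = Pauli.I ∨ M j = Pauli.Z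

/-- The set of measured nodes. -/
def measured (M : PauliProduct V) : Finset V := Finset.univ.filter fun j => M j ≠ Pauli.I

end PauliProduct

/-! ## Stabilizer graphs -/

/-- A stabilizer graph: a simple graph whose nodes may carry a self loop, may be hollow (the
others are solid), and may carry a minus sign, in any combination. Self loops are kept apart from
the edges, so that a node is never its own neighbor. -/
structure StabilizerGraph (V : Type*) where
  graph : SimpleGraph V
  loop : Finset V
  hollow : Finset V
  sign : Finset V

namespace StabilizerGraph

variable {V : Type*} [Fintype V] [DecidableEq V]

/-- The set of edges of the graph. -/
noncomputable def edges (G : StabilizerGraph V) : Finset (Sym2 V) :=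
  G.graph.edgeSet.toFinite.toFinset

open scoped Classical in
/-- The neighborhood of a node. -/
noncomputable def nbrs (G : StabilizerGraph V) (j : V) : Finset V :=
  Finset.univ.filter fun k => G.graph.Adj j k

/-- The terminal one-qubit gates at a node: `Z` for a sign, then `S` for a loop, then `H` for a
hollow node. -/
noncomputable def nodeGate (G : StabilizerGraph V) (j : V) : Matrix (Fin 2) (Fin 2) ℂ :=
  (if j ∈ G.hollow then Gate.H else 1) * (if j ∈ G.loop then Gate.S else 1) *
    (if j ∈ G.sign then Gate.Z else 1)

/-- The graph-form circuit: Hadamard gates on all qubits, then a controlled-`Z` gate along every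
edge, then the terminal gates `Z`, `S`, `H` dictated by the decorations. -/
noncomputable def circuit (G : StabilizerGraph V) : QOp V :=
  tensorOp G.nodeGate *
    G.edges.noncommProd Gate.CZedge (fun e _ f _ _ => Gate.CZedge_commute e f) *
    tensorOp fun _ => Gate.H

/-- The stabilizer state represented by the graph. -/
noncomputable def state (G : StabilizerGraph V) : QState V :=
  G.circuit *ᵥ zeroState V

/-! ### The sets attached to a measurement -/

/-- The measured solid nodes. -/
def MS (G : StabilizerGraph V) (M : PauliProduct V) : Finset V := M.measured \ G.hollow

/-- The measured hollow nodes. -/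
def MH (G : StabilizerGraph V) (M : PauliProduct V) : Finset V := M.measured ∩ G.hollow

/-- The measured solid nodes with an even number of measured hollow neighbors. -/
noncomputable def MSE (G : StabilizerGraph V) (M : PauliProduct V) : Finset V :=
  (G.MS M).filter fun j => Even (G.MH M ∩ G.nbrs j).card

/-- The number of measured hollow nodes with a sign. -/
def signCount (G : StabilizerGraph V) (M : PauliProduct V) : ℕ := (G.MH M ∩ G.sign).card

/-- The graph is simplified for the measurement: measured hollow nodes have no loops and are
connected neither to one another nor to unmeasured nodes. -/
def IsSimplifiedFor (G : StabilizerGraph V) (M : PauliProduct V) : Prop :=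
  ∀ j ∈ G.MH M, j ∉ G.loop ∧ (∀ k ∈ G.MH M, ¬ G.graph.Adj j k) ∧
    ∀ k ∉ M.measured, ¬ G.graph.Adj j k

/-! ### Operations on stabilizer graphs -/

/-- Flip the signs of the nodes in `T`. -/
def flipSigns (G : StabilizerGraph V) (T : Finset V) : StabilizerGraph V :=
  { G with sign := G.sign ∆ T }

/-- Advance the loops of the nodes in `T`: a loop is added where there was none; where there was
one, it is removed and the sign is flipped. -/
def advanceLoops (G : StabilizerGraph V) (T : Finset V) : StabilizerGraph V :=
  { G with
    loop := G.loop ∆ T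
    sign := G.sign ∆ (G.loop ∩ T) }

/-- Local complementation on the node `p`: complement all edges between neighbors of `p`. -/
def localComplement (G : StabilizerGraph V) (p : V) : StabilizerGraph V :=
  { G with
    graph :=
      { Adj := fun j k => j ≠ k ∧
          Xor (G.graph.Adj j k) (G.graph.Adj p j ∧ G.graph.Adj p k)
        symm := ⟨fun j k h => ⟨h.1.symm, by
          have h2 := h.2
          rw [G.graph.adj_comm, and_comm (a := G.graph.Adj p j)] at h2
          exact h2⟩⟩
        loopless := ⟨fun j h => h.1 rfl⟩ } }

/-- For each neighbor of `p`, complement all of its edges to (other) nodes of `T`. An edge both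
of whose ends are neighbors of `p` in `T` is complemented twice. -/
def complementNbrsTo (G : StabilizerGraph V) (p : V) (T : Finset V) : StabilizerGraph V :=
  { G with
    graph :=
      { Adj := fun j k => j ≠ k ∧
          Xor (G.graph.Adj j k)
            (Xor (G.graph.Adj p j ∧ k ∈ T) (G.graph.Adj p k ∧ j ∈ T))
        symm := ⟨fun j k h => ⟨h.1.symm, by
          have h2 := h.2
          rw [G.graph.adj_comm, xor_comm (G.graph.Adj p j ∧ k ∈ T)] at h2
          exact h2⟩⟩
        loopless := ⟨fun j h => h.1 rfl⟩ } }

/-- Remove all edges involving `p`, then connect `p` to all nodes of `T` (other than `p`). -/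
def reconnect (G : StabilizerGraph V) (p : V) (T : Finset V) : StabilizerGraph V :=
  { G with
    graph :=
      { Adj := fun j k => (j ≠ p ∧ k ≠ p ∧ G.graph.Adj j k) ∨
          (j = p ∧ k ≠ p ∧ k ∈ T) ∨ (k = p ∧ j ≠ p ∧ j ∈ T)
        symm := ⟨fun j k h => by
          rcases h with ⟨h1, h2, h3⟩ | h | h
          · exact Or.inl ⟨h2, h1, h3.symm⟩
          · exact Or.inr (Or.inr h)
          · exact Or.inr (Or.inl h)⟩
        loopless := ⟨fun j h => by
          rcases h with ⟨_, _, h⟩ | ⟨h1, h2, _⟩ | ⟨h1, h2, _⟩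
          · exact G.graph.loopless.irrefl j h
          · exact h2 h1
          · exact h2 h1⟩ } }

/-! ### The post-measurement graph

`p` is the chosen node, `T` the set of measured solid nodes with an even number of measured hollow
neighbors in the original graph, and `flipped` says that `m` and `b` have different parity. -/

/-- Step 1: for each neighbor of the chosen node, complement all of its edges to unchosen nodes
in `T`. -/
def step1 (G : StabilizerGraph V) (p : V) (T : Finset V) : StabilizerGraph V :=
  G.complementNbrsTo p (T.erase p)

/-- First part of step 2: if the chosen node has no sign, flip the signs of its neighbors in `T`;
otherwise remove its sign and flip the signs of the other nodes in `T` that are not its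
neighbors. -/
noncomputable def step2a (G : StabilizerGraph V) (p : V) (T : Finset V) : StabilizerGraph V :=
  if p ∉ G.sign then G.flipSigns (G.nbrs p ∩ T)
  else { G with sign := G.sign.erase p }.flipSigns (T.erase p \ G.nbrs p)

open scoped Classical in
/-- Second part of step 2: if `m` and `b` have different parity, flip the signs of the chosen node
and of all its neighbors. -/
noncomputable def step2b (G : StabilizerGraph V) (p : V) (flipped : Prop) : StabilizerGraph V :=
  if flipped then G.flipSigns (insert p (G.nbrs p)) else G

/-- Step 3: remove all edges involving the chosen node, connect it to all the other nodes in `T`,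
and make it hollow. -/
def step3 (G : StabilizerGraph V) (p : V) (T : Finset V) : StabilizerGraph V :=
  { G.reconnect p (T.erase p) with hollow := insert p G.hollow }

/-- The graph part of step 4 for a chosen node with a loop: remove the loop, perform local
complementation on the node, and advance the loops of its neighbors. -/
noncomputable def step4a (G : StabilizerGraph V) (p : V) : StabilizerGraph V :=
  ({ G with loop := G.loop.erase p }.localComplement p).advanceLoops (G.nbrs p)

open scoped Classical in
/-- Step 4: if the chosen node has a loop, do `step4a` and, if `m` and `b` have different parity,
flip the signs of the unchosen nodes in `T`. -/
noncomputable def step4 (G : StabilizerGraph V) (p : V) (T : Finset V) (flipped : Prop) :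
    StabilizerGraph V :=
  if p ∈ G.loop then
    if flipped then (G.step4a p).flipSigns (T.erase p) else G.step4a p
  else G

/-- The graph obtained from `G` by steps 1–4 for the measurement `M` with outcome `(-1)^m` and
chosen node `p`. -/
noncomputable def measureGraph (G : StabilizerGraph V) (M : PauliProduct V) (p : V) (m : ℕ) :
    StabilizerGraph V :=
  ((((G.step1 p (G.MSE M)).step2a p (G.MSE M)).step2b p (¬ m ≡ G.signCount M [MOD 2])).step3 p
    (G.MSE M)).step4 p (G.MSE M) (¬ m ≡ G.signCount M [MOD 2])

end StabilizerGraph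

/-!
Before the final Hadamard gates, the amplitude of a stabilizer graph at the bit assignment `y` is a
constant times `i ^ q y`, where `q` is the quadratic form modulo 4 of the matrix with the node
decorations (`1` for a loop, `2` for a sign) on the diagonal and the adjacency matrix off it. Off
the diagonal only parities matter, so that every graph operation adds an explicit correction to `q`.

Moving `M` past the final Hadamard gates turns `Z` into `X` on the measured hollow nodes. There
`X` flips bits, which changes `q` by a linear term: `M` maps the state to `(-1) ^ b` times the state
with the signs on `MSE` flipped. The latter is orthogonal to the original state unless `MSE` is
empty, and this determines the probabilities.

The Hadamard gate at the newly hollow node `p` averages the amplitudes at the two values of the bit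
`y p`. After the four steps, `q` is affine in this bit with slope `2 * (s + u)`, where `s` is the
parity of `m + b` and `u` the sum of the other bits in `MSE`; the average is therefore the original
amplitude plus its image under `(-1) ^ m • M`, up to a phase that does not depend on `y`.
-/

section QuadraticForm

variable {ι R : Type*} [Fintype ι] [CommRing R]

theorem dotProduct_mulVec_self_eq_zero_of_alternating {A : Matrix ι ι R}
    (hanti : ∀ j k, A j k = -A k j) (hdiag : ∀ j, A j j = 0) (v : ι → R) :
    v ⬝ᵥ A *ᵥ v = 0 := by
  simp only [dotProduct, Matrix.mulVec, Finset.mul_sum, ← Fintype.sum_prod_type']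
  refine Finset.sum_involution (fun x _ => x.swap) (fun x _ => ?_) (fun x _ hx hswap => hx ?_)
    (fun _ _ => Finset.mem_univ _) (fun _ _ => rfl)
  · rw [Prod.fst_swap, Prod.snd_swap, hanti x.2 x.1]
    ring
  · rw [show x.1 = x.2 from congrArg Prod.snd hswap, hdiag]
    ring

theorem dotProduct_mulVec_self_congr {A B : Matrix ι ι R} (hA : A.IsSymm) (hB : B.IsSymm)
    (hdiag : ∀ j, A j j = B j j) (hoff : ∀ j k, j ≠ k → 2 * A j k = 2 * B j k) (v : ι → R) :
    v ⬝ᵥ A *ᵥ v = v ⬝ᵥ B *ᵥ v := by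
  rw [← sub_eq_zero, ← dotProduct_sub, ← Matrix.sub_mulVec]
  refine dotProduct_mulVec_self_eq_zero_of_alternating (fun j k => ?_) (fun j => ?_) v
  · rcases eq_or_ne j k with rfl | hjk
    · simp [hdiag]
    · rw [Matrix.sub_apply, Matrix.sub_apply, hA.apply, hB.apply]
      linear_combination hoff k j hjk.symm
  · rw [Matrix.sub_apply, hdiag, sub_self]

theorem add_dotProduct_mulVec_add {A : Matrix ι ι R} (hA : A.IsSymm) (v w : ι → R) :
    (v + w) ⬝ᵥ A *ᵥ (v + w) = v ⬝ᵥ A *ᵥ v + 2 * (w ⬝ᵥ A *ᵥ v) + w ⬝ᵥ A *ᵥ w := by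
  have hcross : v ⬝ᵥ A *ᵥ w = w ⬝ᵥ A *ᵥ v := by
    rw [Matrix.dotProduct_mulVec, ← Matrix.mulVec_transpose, hA.eq, dotProduct_comm]
  rw [Matrix.mulVec_add, add_dotProduct, dotProduct_add, dotProduct_add, hcross]
  ring

end QuadraticForm

/-! ## Tensor products of one-qubit gates -/

section Tensor

variable {V : Type*} [Fintype V]

theorem tensorOp_conjTranspose (A : V → Matrix (Fin 2) (Fin 2) ℂ) :
    (tensorOp A)ᴴ = tensorOp fun j => (A j)ᴴ := by
  ext x y
  simp [tensorOp, Matrix.conjTranspose_apply, star_prod]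

theorem tensorOp_one : tensorOp (1 : V → Matrix (Fin 2) (Fin 2) ℂ) = 1 := by
  classical
  ext x y
  simp [tensorOp, Matrix.one_apply, Fintype.prod_ite_zero, funext_iff]

theorem tensorOp_diagonal (d : V → Fin 2 → ℂ) :
    tensorOp (fun j => Matrix.diagonal (d j)) = Matrix.diagonal fun y => ∏ j, d j (y j) := by
  classical
  ext x y
  simp [tensorOp, Matrix.diagonal_apply, Fintype.prod_ite_zero, funext_iff]

variable [DecidableEq V]

theorem tensorOp_mul (A B : V → Matrix (Fin 2) (Fin 2) ℂ) :
    tensorOp (A * B) = tensorOp A * tensorOp B := by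
  ext x y
  simp only [tensorOp, Matrix.of_apply, Pi.mul_apply, Matrix.mul_apply, ← Finset.prod_mul_distrib,
    Fintype.prod_sum]

/-- The one-qubit gate `A` applied to each of the qubits in `T`. -/
def gateOn (A : Matrix (Fin 2) (Fin 2) ℂ) (T : Finset V) : QOp V :=
  tensorOp (T.piecewise (fun _ => A) 1)

theorem gateOn_insert (A : Matrix (Fin 2) (Fin 2) ℂ) {p : V} {T : Finset V} (hp : p ∉ T) :
    gateOn A (insert p T) = gateOn A T * gateOn A {p} := by
  rw [gateOn, gateOn, gateOn, ← tensorOp_mul]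
  congr 1
  funext j
  rcases eq_or_ne j p with rfl | hj
  · simp [hp]
  · simp [Finset.piecewise, hj]

theorem gateOn_conjTranspose_mul_self {A : Matrix (Fin 2) (Fin 2) ℂ} (hA : Aᴴ * A = 1)
    (T : Finset V) : (gateOn A T)ᴴ * gateOn A T = 1 := by
  rw [gateOn, tensorOp_conjTranspose, ← tensorOp_mul, ← tensorOp_one]
  congr 1
  funext j
  by_cases hj : j ∈ T <;> simp [hj, hA]

theorem gateOn_singleton_mulVec (A : Matrix (Fin 2) (Fin 2) ℂ) (p : V) (ψ : QState V)
    (y : V → Fin 2) :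
    (gateOn A {p} *ᵥ ψ) y = ∑ a, A (y p) a * ψ (Function.update y p a) := by
  refine (Fintype.sum_of_injective _ (Function.update_injective y p) _ _ (fun z hz => ?_)
    fun a => ?_).symm
  · obtain ⟨j, hj⟩ : ∃ j, Function.update y p (z p) j ≠ z j :=
      Function.ne_iff.1 fun h => hz ⟨z p, h⟩
    have hjp : j ≠ p := by
      rintro rfl
      exact hj (Function.update_self ..)
    rw [Function.update_of_ne hjp] at hj
    refine mul_eq_zero_of_left (Finset.prod_eq_zero (Finset.mem_univ j) ?_) _
    simp [hjp, hj]
  · have hentry : (gateOn A {p} : QOp V) y (Function.update y p a) = A (y p) a := by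
      refine (Fintype.prod_eq_single p fun j hj => ?_).trans ?_ <;> simp [*]
    exact congrArg (· * ψ _) hentry.symm

theorem gateOn_X_mulVec (T : Finset V) (ψ : QState V) (y : V → Fin 2) :
    (gateOn Gate.X T *ᵥ ψ) y = ψ (T.piecewise (y + 1) y) := by
  have hfactor (j : V) (a : Fin 2) : T.piecewise (fun _ => Gate.X) 1 j (y j) a =
      if T.piecewise (y + 1) y j = a then 1 else 0 := by
    by_cases hj : j ∈ T
    · simp only [hj, Finset.piecewise_eq_of_mem, Pi.add_apply, Pi.one_apply, Gate.X]
      generalize y j = c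
      fin_cases a <;> fin_cases c <;> simp
    · simp [hj, Matrix.one_apply]
  simp only [gateOn, tensorOp, Matrix.mulVec, dotProduct, Matrix.of_apply, hfactor,
    Fintype.prod_boole, ← funext_iff, ite_mul, one_mul, zero_mul, Finset.sum_ite_eq,
    Finset.mem_univ, if_true]

end Tensor

theorem star_mulVec_dotProduct_mulVec {n α : Type*} [Fintype n] [DecidableEq n] [CommRing α]
    [StarRing α] {U : Matrix n n α} (hU : Uᴴ * U = 1) (v w : n → α) :
    star (U *ᵥ v) ⬝ᵥ (U *ᵥ w) = star v ⬝ᵥ w := by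
  rw [Matrix.star_mulVec, ← Matrix.dotProduct_mulVec, Matrix.mulVec_mulVec, hU, Matrix.one_mulVec]

/-! ## Measurements -/

section Measurement

variable {V : Type*} [Fintype V] [DecidableEq V] {A : QOp V} {ψ : QState V}

theorem outcomeProj_mulVec (A : QOp V) (ψ : QState V) (m : ℕ) :
    outcomeProj A m *ᵥ ψ = (1 / 2 : ℂ) • (ψ + (-1 : ℂ) ^ m • (A *ᵥ ψ)) := by
  rw [outcomeProj, Matrix.smul_mulVec, Matrix.add_mulVec, Matrix.one_mulVec, Matrix.smul_mulVec]

theorem outcomeProj_mulVec_of_eigenvector {n : ℕ} (hA : A *ᵥ ψ = (-1 : ℂ) ^ n • ψ) (m : ℕ) :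
    outcomeProj A m *ᵥ ψ = if Even (m + n) then ψ else 0 := by
  rw [outcomeProj_mulVec, hA, smul_smul, ← pow_add, neg_one_pow_eq_ite]
  split_ifs
  · rw [one_smul, ← two_smul ℂ ψ, smul_smul, one_div_mul_cancel two_ne_zero, one_smul]
  · simp

theorem outcomeProb_of_eigenvector (hψ : star ψ ⬝ᵥ ψ = 1) {n : ℕ}
    (hA : A *ᵥ ψ = (-1 : ℂ) ^ n • ψ) (m : ℕ) :
    outcomeProb A ψ m = if Even (m + n) then 1 else 0 := by
  rw [outcomeProb, outcomeProj_mulVec_of_eigenvector hA]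
  split_ifs <;> simp [hψ]

theorem postState_of_eigenvector (hψ : star ψ ⬝ᵥ ψ = 1) {n : ℕ}
    (hA : A *ᵥ ψ = (-1 : ℂ) ^ n • ψ) : postState A ψ n = ψ := by
  rw [postState, outcomeProb_of_eigenvector hψ hA, outcomeProj_mulVec_of_eigenvector hA]
  simp

theorem outcomeProb_of_expectation_eq_zero (hψ : star ψ ⬝ᵥ ψ = 1)
    (hA : star ψ ⬝ᵥ (A *ᵥ ψ) = 0) (m : ℕ) : outcomeProb A ψ m = 1 / 2 := by
  rw [outcomeProb, outcomeProj_mulVec, dotProduct_smul, dotProduct_add, dotProduct_smul, hψ, hA]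
  simp

theorem postState_of_expectation_eq_zero (hψ : star ψ ⬝ᵥ ψ = 1)
    (hA : star ψ ⬝ᵥ (A *ᵥ ψ) = 0) (m : ℕ) :
    postState A ψ m = (√2 : ℂ)⁻¹ • (ψ + (-1 : ℂ) ^ m • (A *ᵥ ψ)) := by
  have hnorm : (√(1 / 2 : ℝ))⁻¹ * (1 / 2) = (√2)⁻¹ := by
    rw [Real.sqrt_div zero_le_one, Real.sqrt_one, one_div, inv_inv, mul_one_div,
      Real.sqrt_div_self', one_div]
  rw [postState, outcomeProb_of_expectation_eq_zero hψ hA, outcomeProj_mulVec, smul_smul,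
    ← Complex.ofReal_inv (√2), ← hnorm]
  push_cast
  rfl

end Measurement

/-! ## Fourth roots of unity -/

/-- The character `a ↦ i ^ a` of `ℤ / 4`, through which all amplitudes are expressed. -/
noncomputable def phase : AddChar (ZMod 4) ℂ := AddChar.zmodChar 4 Complex.I_pow_four

theorem phase_one : phase 1 = Complex.I := by
  rw [phase, AddChar.zmodChar_apply, show (1 : ZMod 4).val = 1 from rfl, pow_one]

theorem phase_two : phase 2 = -1 := by
  rw [phase, AddChar.zmodChar_apply, show (2 : ZMod 4).val = 2 from rfl, Complex.I_sq]

theorem phase_two_mul_natCast (n : ℕ) : phase (2 * n) = (-1) ^ n := by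
  rw [mul_comm, ← nsmul_eq_mul, AddChar.map_nsmul_eq_pow, phase_two]

theorem norm_phase (a : ZMod 4) : ‖phase a‖ = 1 := by
  rw [phase, AddChar.zmodChar_apply, norm_pow, Complex.norm_I, one_pow]

theorem star_phase_mul_phase (a b : ZMod 4) : star (phase a) * phase b = phase (b - a) := by
  rw [Complex.star_def, ← AddChar.map_neg_eq_conj, ← AddChar.map_add_eq_mul, neg_add_eq_sub]

theorem phase_sum {ι : Type*} (s : Finset ι) (f : ι → ZMod 4) :
    phase (∑ i ∈ s, f i) = ∏ i ∈ s, phase (f i) :=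
  map_prod phase.toMonoidHom (fun i => Multiplicative.ofAdd (f i)) s

theorem two_mul_natCast_zmod_four (n : ℕ) : 2 * (n : ZMod 4) = if Odd n then 2 else 0 := by
  have four_eq_zero : (4 : ZMod 4) = 0 := rfl
  rcases Nat.even_or_odd' n with ⟨r, rfl | rfl⟩
  · rw [if_neg (by simp)]
    push_cast
    linear_combination (r : ZMod 4) * four_eq_zero
  · rw [if_pos (by simp)]
    push_cast
    linear_combination (r : ZMod 4) * four_eq_zero

/-! ## Bit assignments -/

section Bits

variable {V : Type*}

/-- The bit assignment `y` with its entries taken modulo 4, the modulus of the exponents of `i`. -/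
def bits (y : V → Fin 2) (j : V) : ZMod 4 := (y j).val

theorem bits_mul_self (y : V → Fin 2) (j : V) : bits y j * bits y j = bits y j := by
  have val_mul_self : ∀ a : Fin 2, (a.val * a.val : ZMod 4) = a.val := by decide
  exact val_mul_self (y j)

/-- The sum of the bits of `y` at the nodes in `T`, modulo 4. -/
def bitSum (T : Finset V) (y : V → Fin 2) : ZMod 4 := ∑ j ∈ T, bits y j

variable [DecidableEq V]

theorem bitSum_insert {p : V} {T : Finset V} (hp : p ∉ T) (y : V → Fin 2) :
    bitSum (insert p T) y = bits y p + bitSum T y :=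
  Finset.sum_insert hp

theorem bits_add_bitSum_erase {p : V} {T : Finset V} (hp : p ∈ T) (y : V → Fin 2) :
    bits y p + bitSum (T.erase p) y = bitSum T y :=
  Finset.add_sum_erase T _ hp

theorem bitSum_sdiff (S T : Finset V) (y : V → Fin 2) :
    bitSum (S \ T) y = bitSum S y - bitSum (T ∩ S) y := by
  rw [eq_sub_iff_add_eq, bitSum, bitSum, bitSum, Finset.inter_comm]
  exact (add_comm _ _).trans (Finset.sum_inter_add_sum_sdiff S T _)

theorem bitSum_update {p : V} {T : Finset V} (hp : p ∉ T) (y : V → Fin 2) (a : Fin 2) :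
    bitSum T (Function.update y p a) = bitSum T y :=
  Finset.sum_congr rfl fun j hj => by
    rw [bits, bits, Function.update_of_ne (ne_of_mem_of_not_mem hj hp)]

/-- The indicator function of a set of nodes, with values modulo 4. -/
def nodeIndicator (T : Finset V) (j : V) : ZMod 4 := if j ∈ T then 1 else 0

theorem nodeIndicator_mul_nodeIndicator (S T : Finset V) :
    nodeIndicator S * nodeIndicator T = nodeIndicator (S ∩ T) := by
  funext j
  simp only [Pi.mul_apply, nodeIndicator, Finset.mem_inter, ite_and, ite_mul, one_mul, zero_mul]

theorem bits_update (y : V → Fin 2) (p : V) (a : Fin 2) :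
    bits (Function.update y p a) = bits y + Pi.single p ((a.val : ZMod 4) - bits y p) := by
  funext j
  rcases eq_or_ne j p with rfl | hj
  · simp [bits]
  · simp [bits, hj]

theorem bits_piecewise_add_one (T : Finset V) (y : V → Fin 2) :
    bits (T.piecewise (y + 1) y) = bits y + nodeIndicator T * (1 - 2 * bits y) := by
  have val_add_one : ∀ a : Fin 2, ((a + 1).val : ZMod 4) = a.val + (1 - 2 * a.val) := by decide
  funext j
  by_cases hj : j ∈ T
  · simpa [bits, nodeIndicator, hj] using val_add_one (y j)
  · simp [bits, nodeIndicator, hj]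

variable [Fintype V]

theorem nodeIndicator_dotProduct (T : Finset V) (v : V → ZMod 4) :
    nodeIndicator T ⬝ᵥ v = ∑ j ∈ T, v j := by
  simp [dotProduct, nodeIndicator]

theorem nodeIndicator_dotProduct_bits (T : Finset V) (y : V → Fin 2) :
    nodeIndicator T ⬝ᵥ bits y = bitSum T y :=
  nodeIndicator_dotProduct T (bits y)

theorem sum_phase_two_mul_bitSum (T : Finset V) :
    ∑ y : V → Fin 2, phase (2 * bitSum T y) = if T = ∅ then 2 ^ Fintype.card V else 0 := by
  have hfactor (j : V) :
      ∑ a : Fin 2, phase (2 * (nodeIndicator T j * a.val)) = if j ∉ T then 2 else 0 := by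
    by_cases hj : j ∈ T
    · simp [nodeIndicator, hj, phase_two]
    · simp [nodeIndicator, hj]
  have hprod (y : V → Fin 2) :
      phase (2 * bitSum T y) = ∏ j, phase (2 * (nodeIndicator T j * (y j).val)) := by
    rw [← nodeIndicator_dotProduct_bits, dotProduct, Finset.mul_sum, phase_sum]
    rfl
  rw [Fintype.sum_congr _ _ hprod,
    ← Fintype.prod_sum fun j (a : Fin 2) => phase (2 * (nodeIndicator T j * a.val)),
    Fintype.prod_congr _ _ hfactor]
  simp only [Fintype.prod_ite_zero, Finset.prod_const, Finset.card_univ,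
    Finset.eq_empty_iff_forall_notMem]

end Bits

/-! ## One-qubit and controlled gates -/

namespace Gate

theorem H_apply (a c : Fin 2) : H a c = (√2 : ℂ)⁻¹ * phase (2 * (a.val * c.val)) := by
  fin_cases a <;> fin_cases c <;> simp [H, phase_two]

theorem H_conjTranspose_mul_self : Hᴴ * H = 1 := by
  have two_mul_inv_sqrt_two_sq : (√2 : ℂ)⁻¹ * (√2 : ℂ)⁻¹ + (√2 : ℂ)⁻¹ * (√2 : ℂ)⁻¹ = 1 := by
    rw [← mul_inv, ← Complex.ofReal_mul, Real.mul_self_sqrt zero_le_two, Complex.ofReal_ofNat,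
      ← two_mul, mul_inv_cancel₀ two_ne_zero]
  ext a c
  fin_cases a <;> fin_cases c <;>
    simp [H, Matrix.mul_apply, Complex.conj_ofReal, two_mul_inv_sqrt_two_sq]

theorem Z_mul_H : Z * H = H * X := by
  ext a c
  fin_cases a <;> fin_cases c <;> simp [H, Z, X]

theorem Z_eq_diagonal : Z = Matrix.diagonal fun a : Fin 2 => phase (2 * a.val) := by
  ext a c
  fin_cases a <;> fin_cases c <;> simp [Z, phase_two]

theorem S_eq_diagonal : S = Matrix.diagonal fun a : Fin 2 => phase a.val := by
  ext a c
  fin_cases a <;> fin_cases c <;> simp [S, phase_one]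

end Gate

theorem bits_dotProduct_diagonal_mulVec_bits {V : Type*} [Fintype V] [DecidableEq V]
    (c : V → ZMod 4) (y : V → Fin 2) :
    bits y ⬝ᵥ Matrix.diagonal c *ᵥ bits y = c ⬝ᵥ bits y :=
  Finset.sum_congr rfl fun j _ => by
    rw [Matrix.mulVec_diagonal, mul_left_comm, bits_mul_self]

/-! ## The quadratic form of a stabilizer graph -/

namespace StabilizerGraph

section Nbrs

variable {V : Type*} [Fintype V] (G : StabilizerGraph V)

theorem mem_nbrs {j k : V} : k ∈ G.nbrs j ↔ G.graph.Adj j k := by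
  simp [nbrs]

theorem notMem_nbrs_self (j : V) : j ∉ G.nbrs j := by
  simp [mem_nbrs]

theorem mem_nbrs_comm {j k : V} : k ∈ G.nbrs j ↔ j ∈ G.nbrs k := by
  rw [mem_nbrs, mem_nbrs, G.graph.adj_comm]

end Nbrs

variable {V : Type*} [DecidableEq V] (G : StabilizerGraph V)

/-- The exponent of `i` contributed by the gates `Z` and `S` at a node in the state `1`: a loop
counts `1`, a sign counts `2`. -/
def nodePhase : V → ZMod 4 := nodeIndicator G.loop + 2 * nodeIndicator G.sign

open scoped Classical in
/-- The symmetric matrix modulo 4 of the quadratic form of a stabilizer graph, with the node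
phases on the diagonal and the adjacency matrix off it. Every edge is met twice in the quadratic
form, so that off the diagonal only the parity of an entry matters. -/
noncomputable def phaseMatrix : Matrix V V (ZMod 4) :=
  Matrix.diagonal G.nodePhase + G.graph.adjMatrix (ZMod 4)

theorem phaseMatrix_isSymm : G.phaseMatrix.IsSymm := by
  classical exact (Matrix.isSymm_diagonal _).add (G.graph.isSymm_adjMatrix)

theorem phaseMatrix_apply_self (j : V) : G.phaseMatrix j j = G.nodePhase j := by
  simp [phaseMatrix]

variable [Fintype V]

theorem phaseMatrix_apply_of_ne {j k : V} (hjk : j ≠ k) :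
    G.phaseMatrix j k = nodeIndicator (G.nbrs j) k := by
  by_cases h : G.graph.Adj j k <;>
    simp [phaseMatrix, hjk, nodeIndicator, SimpleGraph.adjMatrix_apply, mem_nbrs, h]

theorem phaseMatrix_mulVec_apply (v : V → ZMod 4) (j : V) :
    (G.phaseMatrix *ᵥ v) j = G.nodePhase j * v j + ∑ k ∈ G.nbrs j, v k := by
  rw [phaseMatrix, Matrix.add_mulVec, Pi.add_apply, Matrix.mulVec_diagonal,
    SimpleGraph.adjMatrix_mulVec_apply]
  congr 2
  ext k
  rw [mem_nbrs, SimpleGraph.mem_neighborFinset]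

/-- The quadratic form of a stabilizer graph: the exponent of `i` in the amplitude at `y` before
the final Hadamard gates. -/
noncomputable def phaseExponent (y : V → Fin 2) : ZMod 4 :=
  bits y ⬝ᵥ G.phaseMatrix *ᵥ bits y

theorem phaseExponent_update (p : V) (y : V → Fin 2) (a : Fin 2) :
    G.phaseExponent (Function.update y p a) = G.phaseExponent y +
      ((a.val : ZMod 4) - bits y p) * (G.nodePhase p + 2 * bitSum (G.nbrs p) y) := by
  have val_mul_self : ∀ c : Fin 2, (c.val * c.val : ZMod 4) = c.val := by decide
  rw [phaseExponent, bits_update, add_dotProduct_mulVec_add G.phaseMatrix_isSymm,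
    single_dotProduct, phaseMatrix_mulVec_apply, Matrix.mulVec_single, single_dotProduct,
    Pi.smul_apply, Matrix.col_apply, phaseMatrix_apply_self, op_smul_eq_mul,
    phaseExponent, bitSum]
  linear_combination G.nodePhase p * (val_mul_self a - bits_mul_self y p)

/-- The nodes with an odd number of neighbors in `T`, on which the gates `X` on `T` act as `Z`. -/
noncomputable def oddNbrs (T : Finset V) : Finset V :=
  Finset.univ.filter fun j => Odd (T ∩ G.nbrs j).card

theorem two_mul_sum_bitSum_nbrs (T : Finset V) (y : V → Fin 2) :
    2 * ∑ j ∈ T, bitSum (G.nbrs j) y = 2 * bitSum (G.oddNbrs T) y := by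
  have hcomm : ∑ j ∈ T, bitSum (G.nbrs j) y = ∑ k, ∑ _j ∈ T ∩ G.nbrs k, bits y k :=
    Finset.sum_comm' fun j k => by
      simp only [Finset.mem_inter, Finset.mem_univ, and_true, G.mem_nbrs_comm (j := j)]
  rw [hcomm, bitSum, oddNbrs, Finset.sum_filter, Finset.mul_sum, Finset.mul_sum]
  refine Finset.sum_congr rfl fun k _ => ?_
  rw [Finset.sum_const, nsmul_eq_mul, ← mul_assoc, two_mul_natCast_zmod_four, ite_mul, zero_mul,
    mul_ite, mul_zero]

theorem dotProduct_phaseMatrix_mulVec_self_of_isIndepSet {T : Finset V}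
    (hindep : G.graph.IsIndepSet T) {w : V → ZMod 4} (hw : ∀ j ∉ T, w j = 0) :
    w ⬝ᵥ G.phaseMatrix *ᵥ w = ∑ j ∈ T, G.nodePhase j * w j ^ 2 := by
  have hnbrs : ∀ j ∈ T, ∑ k ∈ G.nbrs j, w k = 0 := fun j hj => Finset.sum_eq_zero fun k hk =>
    hw k fun hkT =>
      hindep hj hkT (ne_of_mem_of_not_mem hk (G.notMem_nbrs_self j)).symm (G.mem_nbrs.1 hk)
  rw [dotProduct, ← Finset.sum_subset T.subset_univ fun j _ hj => by rw [hw j hj, zero_mul]]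
  refine Finset.sum_congr rfl fun j hj => ?_
  rw [phaseMatrix_mulVec_apply, hnbrs j hj]
  ring

theorem phaseExponent_piecewise_add_one {T : Finset V} (hindep : G.graph.IsIndepSet T)
    (hloop : Disjoint T G.loop) (y : V → Fin 2) :
    G.phaseExponent (T.piecewise (y + 1) y) =
      G.phaseExponent y + 2 * (T ∩ G.sign).card + 2 * bitSum (G.oddNbrs T) y := by
  have four_eq_zero : (4 : ZMod 4) = 0 := rfl
  set w := nodeIndicator T * (1 - 2 * bits y) with hw
  have hwT : ∀ j ∈ T, w j = 1 - 2 * bits y j := fun j hj => by simp [hw, nodeIndicator, hj]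
  have hwTc : ∀ j ∉ T, w j = 0 := fun j hj => by simp [hw, nodeIndicator, hj]
  have hnode : ∀ j ∈ T, G.nodePhase j = 2 * nodeIndicator G.sign j := fun j hj => by
    simp [nodePhase, nodeIndicator, Finset.disjoint_left.1 hloop hj]
  have hcross : 2 * (w ⬝ᵥ G.phaseMatrix *ᵥ bits y) = 2 * bitSum (G.oddNbrs T) y := by
    rw [← two_mul_sum_bitSum_nbrs, dotProduct,
      ← Finset.sum_subset T.subset_univ fun j _ hj => by rw [hwTc j hj, zero_mul],
      Finset.mul_sum, Finset.mul_sum]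
    refine Finset.sum_congr rfl fun j hj => ?_
    rw [phaseMatrix_mulVec_apply, hwT j hj, hnode j hj, ← bitSum]
    linear_combination ((1 - 2 * bits y j) * nodeIndicator G.sign j * bits y j -
      bits y j * bitSum (G.nbrs j) y) * four_eq_zero
  have hself : w ⬝ᵥ G.phaseMatrix *ᵥ w = 2 * (T ∩ G.sign).card := by
    rw [G.dotProduct_phaseMatrix_mulVec_self_of_isIndepSet hindep hwTc,
      ← Finset.filter_mem_eq_inter, Finset.natCast_card_filter, Finset.mul_sum]
    refine Finset.sum_congr rfl fun j hj => ?_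
    rw [hwT j hj, hnode j hj, nodeIndicator]
    linear_combination
      (2 * (if j ∈ G.sign then 1 else 0) * (bits y j ^ 2 - bits y j)) * four_eq_zero
  rw [phaseExponent, bits_piecewise_add_one, add_dotProduct_mulVec_add G.phaseMatrix_isSymm,
    hcross, hself, phaseExponent]
  ring

variable {G} {G' : StabilizerGraph V}

theorem phaseExponent_of_nodePhase_add (hgraph : G'.graph = G.graph) {c : V → ZMod 4}
    (hnode : G'.nodePhase = G.nodePhase + c) (y : V → Fin 2) :
    G'.phaseExponent y = G.phaseExponent y + c ⬝ᵥ bits y := by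
  have hmatrix : G'.phaseMatrix = G.phaseMatrix + Matrix.diagonal c := by
    rw [phaseMatrix, phaseMatrix, hnode, hgraph, add_right_comm, Matrix.diagonal_add]
    rfl
  rw [phaseExponent, hmatrix, Matrix.add_mulVec, dotProduct_add,
    bits_dotProduct_diagonal_mulVec_bits, phaseExponent]

theorem phaseExponent_of_nbrs_add (hnode : G'.nodePhase = G.nodePhase)
    {C : Matrix V V (ZMod 4)} (hC : C.IsSymm)
    (hnbrs : ∀ j k, j ≠ k → 2 * nodeIndicator (G'.nbrs j) k =
      2 * (nodeIndicator (G.nbrs j) k + C j k)) (y : V → Fin 2) :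
    G'.phaseExponent y =
      G.phaseExponent y + (bits y ⬝ᵥ C *ᵥ bits y - C.diag ⬝ᵥ bits y) := by
  have hsymm : (G.phaseMatrix + (C - Matrix.diagonal C.diag)).IsSymm :=
    G.phaseMatrix_isSymm.add (hC.sub (Matrix.isSymm_diagonal _))
  rw [phaseExponent, dotProduct_mulVec_self_congr G'.phaseMatrix_isSymm hsymm,
    Matrix.add_mulVec, Matrix.sub_mulVec, dotProduct_add, dotProduct_sub,
    bits_dotProduct_diagonal_mulVec_bits, phaseExponent]
  · intro j
    simp [phaseMatrix_apply_self, hnode]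
  · intro j k hjk
    rw [phaseMatrix_apply_of_ne _ hjk, hnbrs j k hjk, Matrix.add_apply,
      phaseMatrix_apply_of_ne _ hjk, Matrix.sub_apply, Matrix.diagonal_apply_ne _ hjk, sub_zero]

end StabilizerGraph

/-! ## The amplitudes of a graph state -/

theorem sum_ite_sym2_mk_mem {V M : Type*} [Fintype V] [DecidableEq V] [AddCommMonoid M]
    {E : Finset (Sym2 V)} (hE : ∀ e ∈ E, ¬ e.IsDiag) (f : Sym2 V → M) :
    ∑ x : V × V, (if s(x.1, x.2) ∈ E then f s(x.1, x.2) else 0) = 2 • ∑ e ∈ E, f e := by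
  rw [← Finset.sum_filter, Finset.smul_sum,
    ← Finset.sum_fiberwise_of_maps_to (t := E) (g := fun x : V × V => s(x.1, x.2))
      fun x hx => (Finset.mem_filter.1 hx).2]
  refine Finset.sum_congr rfl fun e he => ?_
  induction e with
  | _ a c =>
    have hac : (a, c) ≠ (c, a) := fun h => hE _ he (congrArg Prod.fst h)
    have hfiber : (Finset.univ.filter fun x : V × V => s(x.1, x.2) ∈ E).filter
        (fun x => s(x.1, x.2) = s(a, c)) = {(a, c), (c, a)} := by
      ext ⟨j, k⟩
      simp only [Finset.mem_filter, Finset.mem_univ, true_and, Finset.mem_insert,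
        Finset.mem_singleton, Prod.mk.injEq, ← Sym2.eq_iff]
      exact and_iff_right_of_imp fun h => h ▸ he
    rw [hfiber, Finset.sum_pair hac, two_smul, Sym2.eq_swap (a := c)]

namespace Gate

variable {V : Type*} [Fintype V] [DecidableEq V]

theorem CZedge_eq_diagonal (e : Sym2 V) :
    (CZedge e : QOp V) = Matrix.diagonal fun y => phase (2 * (e.map (bits y)).mul) := by
  induction e with
  | _ j k =>
    have hphase : ∀ a c : Fin 2, phase (2 * (a.val * c.val)) = if a = 1 ∧ c = 1 then -1 else 1 := by
      simp [Fin.forall_fin_two, phase_two]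
    exact congrArg Matrix.diagonal (funext fun y => (hphase (y j) (y k)).symm)

theorem noncommProd_CZedge (E : Finset (Sym2 V))
    (comm : (E : Set (Sym2 V)).Pairwise (Function.onFun Commute (CZedge (V := V)))) :
    E.noncommProd CZedge comm =
      Matrix.diagonal fun y => phase (2 * ∑ e ∈ E, (e.map (bits y)).mul) := by
  induction E using Finset.induction_on with
  | empty => simp
  | insert e E he ih =>
    rw [Finset.noncommProd_insert_of_notMem _ _ _ _ he, ih, CZedge_eq_diagonal,
      Matrix.diagonal_mul_diagonal]
    simp only [← AddChar.map_add_eq_mul, ← mul_add, Finset.sum_insert he]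

end Gate

namespace StabilizerGraph

variable {V : Type*} [Fintype V] [DecidableEq V] (G : StabilizerGraph V)

theorem phaseExponent_eq_sum_edges (y : V → Fin 2) :
    G.phaseExponent y = G.nodePhase ⬝ᵥ bits y + 2 * ∑ e ∈ G.edges, (e.map (bits y)).mul := by
  classical
  have mem_edges {j k : V} : s(j, k) ∈ G.edges ↔ G.graph.Adj j k := by simp [edges]
  have hdiag : ∀ e ∈ G.edges, ¬ e.IsDiag := fun e he =>
    G.graph.not_isDiag_of_mem_edgeSet (by simpa [edges] using he)
  rw [phaseExponent, phaseMatrix, Matrix.add_mulVec, dotProduct_add,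
    bits_dotProduct_diagonal_mulVec_bits, SimpleGraph.dotProduct_mulVec_adjMatrix,
    ← Nat.cast_two, ← nsmul_eq_mul, ← sum_ite_sym2_mk_mem hdiag, Fintype.sum_prod_type]
  simp only [mem_edges, Sym2.map_mk, Sym2.mul_mk]

theorem tensorOp_nodeGate :
    tensorOp G.nodeGate =
      gateOn Gate.H G.hollow * Matrix.diagonal fun y => phase (G.nodePhase ⬝ᵥ bits y) := by
  have hgate : G.nodeGate = G.hollow.piecewise (fun _ => Gate.H) 1 *
      fun j => Matrix.diagonal fun a => phase (G.nodePhase j * a.val) := by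
    funext j
    rw [nodeGate, mul_assoc, Pi.mul_apply]
    congr 1
    by_cases hloop : j ∈ G.loop <;> by_cases hsign : j ∈ G.sign <;>
      simp [hloop, hsign, nodePhase, nodeIndicator, Gate.S_eq_diagonal, Gate.Z_eq_diagonal,
        ← AddChar.map_add_eq_mul, add_mul]
  rw [hgate, tensorOp_mul, tensorOp_diagonal]
  simp only [dotProduct, phase_sum]
  rfl

/-- The state of a stabilizer graph before the final Hadamard gates at the hollow nodes. -/
noncomputable def solidState : QState V := fun y =>
  (√2 : ℂ)⁻¹ ^ Fintype.card V * phase (G.phaseExponent y)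

theorem state_eq_gateOn_H_mulVec_solidState :
    G.state = gateOn Gate.H G.hollow *ᵥ G.solidState := by
  have huniform : (tensorOp fun _ : V => Gate.H) *ᵥ zeroState V =
      fun _ => (√2 : ℂ)⁻¹ ^ Fintype.card V := by
    funext y
    simp [zeroState, tensorOp, Gate.H_apply]
  have hcircuit : G.circuit = _ :=
    congrArg (fun D => tensorOp G.nodeGate * D * tensorOp fun _ => Gate.H)
      (Gate.noncommProd_CZedge G.edges fun e _ f _ _ => Gate.CZedge_commute e f)
  rw [state, hcircuit, tensorOp_nodeGate, ← Matrix.mulVec_mulVec, huniform, mul_assoc,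
    ← Matrix.mulVec_mulVec, Matrix.diagonal_mul_diagonal]
  congr 1
  funext y
  rw [Matrix.mulVec_diagonal, ← AddChar.map_add_eq_mul, ← phaseExponent_eq_sum_edges, mul_comm,
    solidState]

end StabilizerGraph

/-! ## The action of a measurement on a graph state -/

theorem nodeIndicator_symmDiff_add_two_mul_inter {V : Type*} [DecidableEq V] (S T : Finset V) :
    nodeIndicator (S ∆ T) + 2 * nodeIndicator (S ∩ T) = nodeIndicator S + nodeIndicator T := by
  funext j
  by_cases hS : j ∈ S <;> by_cases hT : j ∈ T <;>
    simp [nodeIndicator, Finset.mem_symmDiff, hS, hT, one_add_one_eq_two]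

theorem two_mul_nodeIndicator_symmDiff {V : Type*} [DecidableEq V] (S T : Finset V) :
    2 * nodeIndicator (S ∆ T) = 2 * nodeIndicator S + 2 * nodeIndicator T := by
  have four_eq_zero : (4 : V → ZMod 4) = 0 := rfl
  linear_combination 2 * nodeIndicator_symmDiff_add_two_mul_inter S T -
    nodeIndicator (S ∩ T) * four_eq_zero

section PauliGates

variable {V : Type*} [Fintype V] [DecidableEq V]

theorem gateOn_Z (T : Finset V) :
    gateOn Gate.Z T = Matrix.diagonal fun y => phase (2 * bitSum T y) := by
  have hgate : T.piecewise (fun _ => Gate.Z) 1 =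
      fun j => Matrix.diagonal fun a => phase (2 * (nodeIndicator T j * a.val)) := by
    funext j
    by_cases hj : j ∈ T <;> simp [hj, nodeIndicator, Gate.Z_eq_diagonal]
  rw [gateOn, hgate, tensorOp_diagonal]
  simp only [← nodeIndicator_dotProduct_bits, dotProduct, Finset.mul_sum, phase_sum]
  rfl

theorem gateOn_Z_mul_gateOn_H (S T : Finset V) :
    gateOn Gate.Z S * gateOn Gate.H T =
      gateOn Gate.H T * (gateOn Gate.Z (S \ T) * gateOn Gate.X (S ∩ T)) := by
  simp only [gateOn, ← tensorOp_mul]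
  congr 1
  funext j
  by_cases hS : j ∈ S <;> by_cases hT : j ∈ T <;> simp [hS, hT, Gate.Z_mul_H]

theorem PauliProduct.IsZType.toOp_eq_gateOn_Z {M : PauliProduct V} (hZ : M.IsZType) :
    M.toOp = gateOn Gate.Z M.measured := by
  rw [toOp, gateOn]
  congr 1
  funext j
  rcases hZ j with hj | hj <;> simp [hj, measured, Finset.piecewise, Pauli.toMatrix]

end PauliGates

namespace StabilizerGraph

variable {V : Type*} [DecidableEq V] (G : StabilizerGraph V)

theorem flipSigns_empty : G.flipSigns ∅ = G := by
  rw [flipSigns, ← Finset.bot_eq_empty, symmDiff_bot]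

theorem flipSigns_flipSigns (S T : Finset V) :
    (G.flipSigns S).flipSigns T = G.flipSigns (S ∆ T) := by
  simp only [flipSigns, symmDiff_assoc]

variable [Fintype V]

theorem phaseExponent_flipSigns (T : Finset V) (y : V → Fin 2) :
    (G.flipSigns T).phaseExponent y = G.phaseExponent y + 2 * bitSum T y := by
  have hnode : (G.flipSigns T).nodePhase = G.nodePhase + (2 : ZMod 4) • nodeIndicator T := by
    rw [nodePhase, flipSigns, two_mul_nodeIndicator_symmDiff, nodePhase, ← add_assoc]
    rfl
  rw [phaseExponent_of_nodePhase_add (by rfl) hnode, smul_dotProduct,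
    nodeIndicator_dotProduct_bits, smul_eq_mul]

theorem gateOn_Z_mulVec_solidState (T : Finset V) :
    gateOn Gate.Z T *ᵥ G.solidState = (G.flipSigns T).solidState := by
  funext y
  rw [gateOn_Z, Matrix.mulVec_diagonal, solidState, solidState, phaseExponent_flipSigns,
    AddChar.map_add_eq_mul]
  ring

theorem gateOn_X_mulVec_solidState {T : Finset V} (hindep : G.graph.IsIndepSet T)
    (hloop : Disjoint T G.loop) :
    gateOn Gate.X T *ᵥ G.solidState =
      (-1 : ℂ) ^ (T ∩ G.sign).card • (G.flipSigns (G.oddNbrs T)).solidState := by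
  funext y
  rw [gateOn_X_mulVec, Pi.smul_apply, solidState, solidState,
    G.phaseExponent_piecewise_add_one hindep hloop, phaseExponent_flipSigns, add_right_comm,
    AddChar.map_add_eq_mul, phase_two_mul_natCast, smul_eq_mul]
  ring

variable {G} {M : PauliProduct V}

theorem IsSimplifiedFor.isIndepSet_MH (hG : G.IsSimplifiedFor M) :
    G.graph.IsIndepSet (G.MH M) :=
  fun j hj k hk _ => (hG j hj).2.1 k hk

theorem IsSimplifiedFor.disjoint_MH_loop (hG : G.IsSimplifiedFor M) :
    Disjoint (G.MH M) G.loop :=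
  Finset.disjoint_left.2 fun j hj => (hG j hj).1

theorem IsSimplifiedFor.oddNbrs_MH_subset_MS (hG : G.IsSimplifiedFor M) :
    G.oddNbrs (G.MH M) ⊆ G.MS M := by
  intro j hj
  obtain ⟨k, hk⟩ := Finset.card_pos.1 (Finset.mem_filter.1 hj).2.pos
  obtain ⟨hkM, hkj⟩ := Finset.mem_inter.1 hk
  have hadj : G.graph.Adj k j := (G.mem_nbrs.1 hkj).symm
  have hmeasured : j ∈ M.measured := of_not_not fun h => (hG k hkM).2.2 j h hadj
  exact Finset.mem_sdiff.2
    ⟨hmeasured, fun h => (hG k hkM).2.1 j (Finset.mem_inter.2 ⟨hmeasured, h⟩) hadj⟩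

theorem IsSimplifiedFor.oddNbrs_MH_symmDiff_MS (hG : G.IsSimplifiedFor M) :
    G.oddNbrs (G.MH M) ∆ G.MS M = G.MSE M := by
  rw [symmDiff_of_le hG.oddNbrs_MH_subset_MS]
  ext j
  simp only [MSE, oddNbrs, Finset.mem_sdiff, Finset.mem_filter, Finset.mem_univ, true_and,
    Nat.not_odd_iff_even]

theorem toOp_mulVec_state (hZ : M.IsZType) (hG : G.IsSimplifiedFor M) :
    M.toOp *ᵥ G.state = (-1 : ℂ) ^ G.signCount M • (G.flipSigns (G.MSE M)).state := by
  have hsolid : (gateOn Gate.Z (G.MS M) * gateOn Gate.X (G.MH M)) *ᵥ G.solidState =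
      (-1 : ℂ) ^ G.signCount M • (G.flipSigns (G.MSE M)).solidState := by
    rw [← Matrix.mulVec_mulVec,
      G.gateOn_X_mulVec_solidState hG.isIndepSet_MH hG.disjoint_MH_loop, Matrix.mulVec_smul,
      gateOn_Z_mulVec_solidState, flipSigns_flipSigns, hG.oddNbrs_MH_symmDiff_MS, signCount]
  rw [hZ.toOp_eq_gateOn_Z, state_eq_gateOn_H_mulVec_solidState, Matrix.mulVec_mulVec,
    gateOn_Z_mul_gateOn_H, ← Matrix.mulVec_mulVec, ← MS, ← MH, hsolid, Matrix.mulVec_smul,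
    state_eq_gateOn_H_mulVec_solidState]
  rfl

theorem star_state_dotProduct_state_flipSigns (G : StabilizerGraph V) (T : Finset V) :
    star G.state ⬝ᵥ (G.flipSigns T).state = if T = ∅ then 1 else 0 := by
  have hnorm : (√2 : ℂ)⁻¹ ^ Fintype.card V * (√2 : ℂ)⁻¹ ^ Fintype.card V =
      (2 ^ Fintype.card V)⁻¹ := by
    rw [← mul_pow, ← mul_inv, ← Complex.ofReal_mul, Real.mul_self_sqrt zero_le_two, inv_pow]
    rfl
  have hterm (y : V → Fin 2) : star (G.solidState y) * (G.flipSigns T).solidState y =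
      (2 ^ Fintype.card V)⁻¹ * phase (2 * bitSum T y) := by
    have hstar : star ((√2 : ℂ)⁻¹ ^ Fintype.card V) = (√2 : ℂ)⁻¹ ^ Fintype.card V := by
      simp [Complex.conj_ofReal]
    rw [solidState, solidState, star_mul', hstar, mul_mul_mul_comm, hnorm, star_phase_mul_phase,
      phaseExponent_flipSigns, add_sub_cancel_left]
  rw [state_eq_gateOn_H_mulVec_solidState, state_eq_gateOn_H_mulVec_solidState, flipSigns,
    star_mulVec_dotProduct_mulVec (gateOn_conjTranspose_mul_self Gate.H_conjTranspose_mul_self _),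
    ← flipSigns]
  simp only [dotProduct, Pi.star_apply, hterm, ← Finset.mul_sum, sum_phase_two_mul_bitSum, mul_ite,
    mul_zero]
  rw [inv_mul_cancel₀ (pow_ne_zero _ two_ne_zero)]

end StabilizerGraph

/-! ## The effect of the graph operations on the quadratic form -/

theorem bits_dotProduct_vecMulVec_mulVec_bits {V : Type*} [Fintype V] (v w : V → ZMod 4)
    (y : V → Fin 2) :
    bits y ⬝ᵥ Matrix.vecMulVec v w *ᵥ bits y = (v ⬝ᵥ bits y) * (w ⬝ᵥ bits y) := by
  rw [Matrix.vecMulVec_mulVec, op_smul_eq_smul, dotProduct_smul, smul_eq_mul,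
    dotProduct_comm (bits y), mul_comm]

namespace StabilizerGraph

variable {V : Type*} [DecidableEq V] (G : StabilizerGraph V)

theorem erase_sign_eq_flipSigns {p : V} (hp : p ∈ G.sign) :
    { G with sign := G.sign.erase p } = G.flipSigns {p} := by
  rw [flipSigns, symmDiff_of_ge (Finset.singleton_subset_iff.2 hp), Finset.sdiff_singleton_eq_erase]

variable [Fintype V]

theorem phaseExponent_of_nbrs_add_mul_add_mul {G G' : StabilizerGraph V}
    (hnode : G'.nodePhase = G.nodePhase) {v w : V → ZMod 4}
    (hnbrs : ∀ j k, j ≠ k → 2 * nodeIndicator (G'.nbrs j) k =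
      2 * (nodeIndicator (G.nbrs j) k + (v j * w k + w j * v k))) (y : V → Fin 2) :
    G'.phaseExponent y =
      G.phaseExponent y + 2 * ((v ⬝ᵥ bits y) * (w ⬝ᵥ bits y) - (v * w) ⬝ᵥ bits y) := by
  have hsymm : (Matrix.vecMulVec v w + Matrix.vecMulVec w v).IsSymm := by
    rw [Matrix.IsSymm, Matrix.transpose_add, Matrix.transpose_vecMulVec,
      Matrix.transpose_vecMulVec, add_comm]
  rw [phaseExponent_of_nbrs_add hnode hsymm hnbrs, Matrix.add_mulVec, dotProduct_add,
    bits_dotProduct_vecMulVec_mulVec_bits, bits_dotProduct_vecMulVec_mulVec_bits,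
    Matrix.diag_add, Matrix.diag_vecMulVec, Matrix.diag_vecMulVec, mul_comm w v, add_dotProduct]
  ring

theorem phaseExponent_advanceLoops (T : Finset V) (y : V → Fin 2) :
    (G.advanceLoops T).phaseExponent y = G.phaseExponent y + bitSum T y := by
  have hnode : (G.advanceLoops T).nodePhase = G.nodePhase + nodeIndicator T := by
    rw [nodePhase, advanceLoops, two_mul_nodeIndicator_symmDiff, nodePhase]
    linear_combination nodeIndicator_symmDiff_add_two_mul_inter G.loop T
  rw [phaseExponent_of_nodePhase_add (by rfl) hnode, nodeIndicator_dotProduct_bits]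

theorem phaseExponent_erase_loop {p : V} (hp : p ∈ G.loop) (y : V → Fin 2) :
    phaseExponent { G with loop := G.loop.erase p } y = G.phaseExponent y - bits y p := by
  have hnode : nodePhase { G with loop := G.loop.erase p } = G.nodePhase + Pi.single p (-1) := by
    funext j
    rcases eq_or_ne j p with rfl | hj
    · simp [nodePhase, nodeIndicator, hp]
    · simp [nodePhase, nodeIndicator, hj]
  rw [phaseExponent_of_nodePhase_add (by rfl) hnode, single_dotProduct, neg_one_mul, sub_eq_add_neg]

theorem phaseExponent_localComplement (p : V) (y : V → Fin 2) :
    (G.localComplement p).phaseExponent y =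
      G.phaseExponent y + (bitSum (G.nbrs p) y ^ 2 - bitSum (G.nbrs p) y) := by
  set n := nodeIndicator (G.nbrs p) with hn
  have hnbrs (j k : V) (hjk : j ≠ k) : 2 * nodeIndicator ((G.localComplement p).nbrs j) k =
      2 * (nodeIndicator (G.nbrs j) k + Matrix.vecMulVec n n j k) := by
    have four_eq_zero : (2 : ZMod 4) * (1 + 1) = 0 := rfl
    by_cases hadj : G.graph.Adj j k <;> by_cases hj : G.graph.Adj p j <;>
      by_cases hk : G.graph.Adj p k <;>
      simp [hn, nodeIndicator, Matrix.vecMulVec_apply, mem_nbrs, localComplement, Xor, hadj, hj, hk,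
        hjk, four_eq_zero]
  have hdiag : (Matrix.vecMulVec n n).diag = n := by
    rw [Matrix.diag_vecMulVec, hn, nodeIndicator_mul_nodeIndicator, Finset.inter_self]
  rw [phaseExponent_of_nbrs_add (by rfl) (Matrix.transpose_vecMulVec n n) hnbrs, hdiag,
    bits_dotProduct_vecMulVec_mulVec_bits, nodeIndicator_dotProduct_bits, sq]

theorem phaseExponent_complementNbrsTo (p : V) (T : Finset V) (y : V → Fin 2) :
    (G.complementNbrsTo p T).phaseExponent y = G.phaseExponent y +
      2 * (bitSum (G.nbrs p) y * bitSum T y - bitSum (G.nbrs p ∩ T) y) := by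
  have hnbrs (j k : V) (hjk : j ≠ k) : 2 * nodeIndicator ((G.complementNbrsTo p T).nbrs j) k =
      2 * (nodeIndicator (G.nbrs j) k + (nodeIndicator (G.nbrs p) j * nodeIndicator T k +
        nodeIndicator T j * nodeIndicator (G.nbrs p) k)) := by
    have two_mul_two : (2 : ZMod 4) * (1 + 1) = 0 := rfl
    have two_mul_three : (2 : ZMod 4) * (1 + (1 + 1)) = 2 := rfl
    by_cases hadj : G.graph.Adj j k <;> by_cases hj : G.graph.Adj p j <;>
      by_cases hk : G.graph.Adj p k <;> by_cases hjT : j ∈ T <;> by_cases hkT : k ∈ T <;>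
      simp [nodeIndicator, mem_nbrs, complementNbrsTo, Xor, hadj, hj, hk, hjk, hjT, hkT,
        two_mul_two, two_mul_three]
  rw [phaseExponent_of_nbrs_add_mul_add_mul (by rfl) hnbrs, nodeIndicator_mul_nodeIndicator]
  simp only [nodeIndicator_dotProduct_bits]

theorem phaseExponent_reconnect {p : V} {T : Finset V} (hp : p ∉ T) (y : V → Fin 2) :
    (G.reconnect p T).phaseExponent y = G.phaseExponent y +
      2 * (bits y p * (bitSum T y - bitSum (G.nbrs p) y)) := by
  have hnbrs (j k : V) (hjk : j ≠ k) : 2 * nodeIndicator ((G.reconnect p T).nbrs j) k =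
      2 * (nodeIndicator (G.nbrs j) k +
        (nodeIndicator {p} j * (nodeIndicator T - nodeIndicator (G.nbrs p)) k +
        (nodeIndicator T - nodeIndicator (G.nbrs p)) j * nodeIndicator {p} k)) := by
    rcases eq_or_ne j p with rfl | hj
    · simp [nodeIndicator, mem_nbrs, reconnect, hjk.symm]
    · rcases eq_or_ne k p with rfl | hk
      · by_cases hadj : G.graph.Adj j k <;>
          simp [nodeIndicator, mem_nbrs, reconnect, hj, G.graph.adj_comm k, hadj]
      · by_cases hadj : G.graph.Adj j k <;>
          simp [nodeIndicator, mem_nbrs, reconnect, hj, hk, hadj]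
  have hdisjoint : nodeIndicator {p} * (nodeIndicator T - nodeIndicator (G.nbrs p)) = 0 := by
    rw [mul_sub, nodeIndicator_mul_nodeIndicator, nodeIndicator_mul_nodeIndicator,
      Finset.singleton_inter_of_notMem hp, Finset.singleton_inter_of_notMem (G.notMem_nbrs_self p),
      sub_self]
  rw [phaseExponent_of_nbrs_add_mul_add_mul (by rfl) hnbrs, hdisjoint, sub_dotProduct,
    zero_dotProduct, sub_zero]
  simp only [nodeIndicator_dotProduct_bits, bitSum, Finset.sum_singleton]

end StabilizerGraph

/-! ## The post-measurement graph -/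

namespace StabilizerGraph

variable {V : Type*} [DecidableEq V] (G : StabilizerGraph V) (p : V) (T : Finset V)
  (flipped : Prop)

variable [Fintype V]

theorem nbrs_step1_self : (G.step1 p T).nbrs p = G.nbrs p := by
  ext k
  rw [mem_nbrs, mem_nbrs]
  by_cases hk : G.graph.Adj p k
  · simp [step1, complementNbrsTo, Xor, hk, hk.ne]
  · simp [step1, complementNbrsTo, Xor, hk]

theorem nbrs_step2a_self : (G.step2a p T).nbrs p = G.nbrs p := by
  unfold step2a
  split_ifs <;> rfl

theorem nbrs_step2b_self : (G.step2b p flipped).nbrs p = G.nbrs p := by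
  unfold step2b
  split_ifs <;> rfl

theorem nbrs_step3_self : (G.step3 p T).nbrs p = T.erase p := by
  ext k
  rw [mem_nbrs]
  rcases eq_or_ne k p with rfl | hk
  · simp
  · simp [step3, reconnect, hk]

theorem loop_step2a : (G.step2a p T).loop = G.loop := by
  unfold step2a
  split_ifs <;> rfl

theorem loop_step2b : (G.step2b p flipped).loop = G.loop := by
  unfold step2b
  split_ifs <;> rfl

theorem hollow_step2a : (G.step2a p T).hollow = G.hollow := by
  unfold step2a
  split_ifs <;> rfl

theorem hollow_step4 : (G.step4 p T flipped).hollow = G.hollow := by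
  unfold step4
  split_ifs <;> rfl

theorem hollow_step2b : (G.step2b p flipped).hollow = G.hollow := by
  unfold step2b
  split_ifs <;> rfl

variable (y : V → Fin 2)

theorem phaseExponent_step1 :
    (G.step1 p T).phaseExponent y = G.phaseExponent y +
      2 * (bitSum (G.nbrs p) y * bitSum (T.erase p) y - bitSum (G.nbrs p ∩ T.erase p) y) :=
  G.phaseExponent_complementNbrsTo p (T.erase p) y

theorem phaseExponent_step2a :
    (G.step2a p T).phaseExponent y = G.phaseExponent y + 2 * bitSum (G.nbrs p ∩ T.erase p) y +
      nodeIndicator G.sign p * (2 * (bits y p + bitSum (T.erase p) y)) := by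
  have four_eq_zero : (4 : ZMod 4) = 0 := rfl
  unfold step2a nodeIndicator
  split_ifs with hp
  · rw [G.erase_sign_eq_flipSigns hp, phaseExponent_flipSigns, phaseExponent_flipSigns,
      bitSum_sdiff, bitSum, Finset.sum_singleton]
    linear_combination -bitSum (G.nbrs p ∩ T.erase p) y * four_eq_zero
  · have hinter : G.nbrs p ∩ T.erase p = G.nbrs p ∩ T := by
      rw [Finset.inter_erase, Finset.erase_eq_of_notMem fun h =>
        G.notMem_nbrs_self p (Finset.mem_inter.1 h).1]
    rw [phaseExponent_flipSigns, hinter, zero_mul, add_zero]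

theorem phaseExponent_step2b [Decidable flipped] :
    (G.step2b p flipped).phaseExponent y = G.phaseExponent y +
      (if flipped then 1 else 0) * (2 * (bits y p + bitSum (G.nbrs p) y)) := by
  unfold step2b
  split_ifs
  · rw [phaseExponent_flipSigns, bitSum_insert (G.notMem_nbrs_self p), one_mul]
  · rw [zero_mul, add_zero]

theorem phaseExponent_step3 :
    (G.step3 p T).phaseExponent y = G.phaseExponent y +
      2 * (bits y p * (bitSum (T.erase p) y - bitSum (G.nbrs p) y)) :=
  G.phaseExponent_reconnect (T.notMem_erase p) y

theorem phaseExponent_step4a {p : V} (hp : p ∈ G.loop) :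
    (G.step4a p).phaseExponent y = G.phaseExponent y + (bitSum (G.nbrs p) y ^ 2 - bits y p) := by
  have hnbrs : nbrs { G with loop := G.loop.erase p } p = G.nbrs p := rfl
  rw [step4a, phaseExponent_advanceLoops, phaseExponent_localComplement,
    G.phaseExponent_erase_loop hp, hnbrs]
  ring

theorem phaseExponent_step4 [Decidable flipped] :
    (G.step4 p T flipped).phaseExponent y = G.phaseExponent y + nodeIndicator G.loop p *
      (bitSum (G.nbrs p) y ^ 2 - bits y p +
        (if flipped then 1 else 0) * (2 * bitSum (T.erase p) y)) := by
  unfold step4 nodeIndicator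
  split_ifs with hp
  · rw [phaseExponent_flipSigns, G.phaseExponent_step4a y hp]
    ring
  · rw [G.phaseExponent_step4a y hp]
    ring
  all_goals rw [zero_mul, add_zero]

/-- The graph obtained from `G` by steps 1–4 with an arbitrary set `T` in place of the measured
solid nodes with an even number of measured hollow neighbors. -/
noncomputable def collapse : StabilizerGraph V :=
  ((((G.step1 p T).step2a p T).step2b p flipped).step3 p T).step4 p T flipped

theorem hollow_collapse : (G.collapse p T flipped).hollow = insert p G.hollow := by
  rw [collapse, hollow_step4, step3, hollow_step2b, hollow_step2a]
  rfl

theorem phaseExponent_collapse [Decidable flipped] {x u n s σ l : ZMod 4} (hx : bits y p = x)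
    (hu : bitSum (T.erase p) y = u) (hn : bitSum (G.nbrs p) y = n)
    (hs : (if flipped then 1 else 0) = s) (hσ : nodeIndicator G.sign p = σ)
    (hl : nodeIndicator G.loop p = l) :
    (G.collapse p T flipped).phaseExponent y = G.phaseExponent y +
      (2 * (n * u) + 2 * σ * (x + u) + 2 * s * (x + n) + 2 * x * (u - n) +
        l * (u ^ 2 - x + 2 * s * u)) := by
  have hsign : (G.step1 p T).sign = G.sign := rfl
  have hloop : ((((G.step1 p T).step2a p T).step2b p flipped).step3 p T).loop = G.loop :=
    (loop_step2b ..).trans (loop_step2a ..)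
  rw [collapse, phaseExponent_step4, hloop, nbrs_step3_self, phaseExponent_step3,
    nbrs_step2b_self, phaseExponent_step2b, nbrs_step2a_self, phaseExponent_step2a, hsign,
    nbrs_step1_self, phaseExponent_step1, hx, hu, hn, hs, hσ, hl]
  ring

theorem phaseExponent_collapse_update [Decidable flipped] {x u n s σ l : ZMod 4}
    (hx : bits y p = x) (hu : bitSum (T.erase p) y = u) (hn : bitSum (G.nbrs p) y = n)
    (hs : (if flipped then 1 else 0) = s) (hσ : nodeIndicator G.sign p = σ)
    (hl : nodeIndicator G.loop p = l) (a : Fin 2) :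
    (G.collapse p T flipped).phaseExponent (Function.update y p a) = G.phaseExponent y +
      (2 * s * n + 2 * (n + σ) * (u - x) + l * (u ^ 2 - x + 2 * s * u)) + 2 * (s + u) * a.val := by
  have four_eq_zero : (4 : ZMod 4) = 0 := rfl
  have hxa : bits (Function.update y p a) p = a.val := by rw [bits, Function.update_self]
  rw [G.phaseExponent_collapse p T flipped _ hxa ((bitSum_update (T.notMem_erase p) y a).trans hu)
    ((bitSum_update (G.notMem_nbrs_self p) y a).trans hn) hs hσ hl, phaseExponent_update,
    nodePhase, Pi.add_apply, Pi.mul_apply, Pi.ofNat_apply, hx, hn, hσ, hl]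
  linear_combination σ * a.val * four_eq_zero

/- Here `x` is the bit at `p`, `u` and `n` are the sums of the bits at the other nodes in `T` and at
the neighbors of `p`, and `s`, `σ`, `l` indicate flipped signs, a sign at `p` and a loop at `p`. -/
theorem collapse_exponent_eq {x s u n σ l : ZMod 4} (hx : x * x = x) (hs : s * s = s)
    (heven : 2 * (x + s + u) = 0) :
    2 * s * n + 2 * (n + σ) * (u - x) + l * (u ^ 2 - x + 2 * s * u) = 2 * s * σ - l * s := by
  have four_eq_zero : (4 : ZMod 4) = 0 := rfl
  have sq_eq_zero : ∀ w : ZMod 4, 2 * w = 0 → w ^ 2 = 0 := by decide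
  linear_combination (n + σ - l * x) * heven - (x * n + x * σ + s * σ) * four_eq_zero +
    l * sq_eq_zero _ heven + l * hx - l * hs

theorem phase_mul_one_add_phase_eq {x s u n σ l : ZMod 4} (hx : x * x = x) (hs : s * s = s) :
    phase (2 * s * n + 2 * (n + σ) * (u - x) + l * (u ^ 2 - x + 2 * s * u)) *
        (1 + phase (2 * (x + s + u))) =
      phase (2 * s * σ - l * s) * (1 + phase (2 * (x + s + u))) := by
  have two_mul_eq : ∀ w : ZMod 4, 2 * w = 0 ∨ 2 * w = 2 := by decide
  rcases two_mul_eq (x + s + u) with heven | hodd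
  · rw [collapse_exponent_eq hx hs heven]
  · rw [hodd, phase_two, add_neg_cancel, mul_zero, mul_zero]

theorem gateOn_H_mulVec_solidState_collapse {p : V} {T : Finset V} (hp : p ∈ T)
    (flipped : Prop) [Decidable flipped] {s : ZMod 4} (hs : (if flipped then 1 else 0) = s) :
    gateOn Gate.H {p} *ᵥ (G.collapse p T flipped).solidState =
      phase (2 * s * nodeIndicator G.sign p - nodeIndicator G.loop p * s) • (√2 : ℂ)⁻¹ •
        (G.solidState + phase (2 * s) • (G.flipSigns T).solidState) := by
  have hss : s * s = s := by
    rw [← hs]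
    split_ifs <;> rfl
  funext y
  set x := bits y p with hx
  set u := bitSum (T.erase p) y with hu
  set c := (√2 : ℂ)⁻¹ ^ Fintype.card V
  have hphase := phase_mul_one_add_phase_eq (u := u) (n := bitSum (G.nbrs p) y)
    (σ := nodeIndicator G.sign p) (l := nodeIndicator G.loop p) (bits_mul_self y p) hss
  rw [gateOn_singleton_mulVec, Fin.sum_univ_two]
  simp only [solidState, Gate.H_apply, Pi.smul_apply, Pi.add_apply, smul_eq_mul,
    G.phaseExponent_collapse_update p T flipped y hx.symm hu.symm rfl hs rfl rfl,
    phaseExponent_flipSigns, ← bits_add_bitSum_erase hp, AddChar.map_add_eq_mul, Fin.val_zero,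
    Fin.val_one, Nat.cast_zero, Nat.cast_one, mul_zero, mul_one, mul_add,
    AddChar.map_zero_eq_one] at hphase ⊢
  rw [show ((y p).val : ZMod 4) = x from rfl]
  linear_combination (√2 : ℂ)⁻¹ * c * phase (G.phaseExponent y) * hphase

theorem state_collapse {p : V} {T : Finset V} (hp : p ∈ T) (hsolid : p ∉ G.hollow)
    (flipped : Prop) [Decidable flipped] {s : ZMod 4} (hs : (if flipped then 1 else 0) = s) :
    (G.collapse p T flipped).state =
      phase (2 * s * nodeIndicator G.sign p - nodeIndicator G.loop p * s) • (√2 : ℂ)⁻¹ •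
        (G.state + phase (2 * s) • (G.flipSigns T).state) := by
  rw [state_eq_gateOn_H_mulVec_solidState, hollow_collapse, gateOn_insert _ hsolid,
    ← Matrix.mulVec_mulVec, G.gateOn_H_mulVec_solidState_collapse hp flipped hs,
    Matrix.mulVec_smul, Matrix.mulVec_smul, Matrix.mulVec_add, Matrix.mulVec_smul,
    G.state_eq_gateOn_H_mulVec_solidState, (G.flipSigns T).state_eq_gateOn_H_mulVec_solidState]
  rfl

theorem sameState_collapse {p : V} {T : Finset V} (hp : p ∈ T) (hsolid : p ∉ G.hollow)
    (flipped : Prop) [Decidable flipped] :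
    SameState ((√2 : ℂ)⁻¹ • (G.state + (if flipped then -1 else 1 : ℂ) • (G.flipSigns T).state))
      (G.collapse p T flipped).state := by
  have hsign : phase (2 * if flipped then 1 else 0) = if flipped then -1 else 1 := by
    split_ifs
    · rw [mul_one, phase_two]
    · rw [mul_zero, AddChar.map_zero_eq_one]
  refine ⟨phase (-(2 * (if flipped then 1 else 0) * nodeIndicator G.sign p -
    nodeIndicator G.loop p * if flipped then 1 else 0)), norm_phase _, ?_⟩
  rw [G.state_collapse hp hsolid flipped rfl, hsign, smul_smul (phase _) (phase _),
    ← AddChar.map_add_eq_mul, neg_add_cancel, AddChar.map_zero_eq_one, one_smul]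

end StabilizerGraph

/-! ## Measuring a graph state -/

namespace StabilizerGraph

variable {V : Type*} [Fintype V] [DecidableEq V] (G : StabilizerGraph V) {M : PauliProduct V}

theorem star_state_dotProduct_state : star G.state ⬝ᵥ G.state = 1 := by
  simpa [flipSigns_empty] using G.star_state_dotProduct_state_flipSigns ∅

variable {G}

theorem toOp_mulVec_state_of_MSE_eq_empty (hZ : M.IsZType) (hG : G.IsSimplifiedFor M)
    (hMSE : G.MSE M = ∅) : M.toOp *ᵥ G.state = (-1 : ℂ) ^ G.signCount M • G.state := by
  rw [toOp_mulVec_state hZ hG, hMSE, flipSigns_empty]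

theorem star_state_dotProduct_toOp_mulVec_state (hZ : M.IsZType) (hG : G.IsSimplifiedFor M)
    (hMSE : G.MSE M ≠ ∅) : star G.state ⬝ᵥ (M.toOp *ᵥ G.state) = 0 := by
  rw [toOp_mulVec_state hZ hG, dotProduct_smul, star_state_dotProduct_state_flipSigns,
    if_neg hMSE, smul_zero]

theorem outcomeProb_state_of_MSE_ne_empty (hZ : M.IsZType) (hG : G.IsSimplifiedFor M)
    (hMSE : G.MSE M ≠ ∅) (m : ℕ) : outcomeProb M.toOp G.state m = 1 / 2 :=
  outcomeProb_of_expectation_eq_zero G.star_state_dotProduct_state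
    (star_state_dotProduct_toOp_mulVec_state hZ hG hMSE) m

theorem sameState_postState_measureGraph (hZ : M.IsZType) (hG : G.IsSimplifiedFor M) {p : V}
    (hp : p ∈ G.MSE M) (m : ℕ) :
    SameState (postState M.toOp G.state m) (G.measureGraph M p m).state := by
  have hsolid : p ∉ G.hollow := (Finset.mem_sdiff.1 (Finset.mem_filter.1 hp).1).2
  have hparity : Even (m + G.signCount M) ↔ m ≡ G.signCount M [MOD 2] := by
    rw [Nat.even_add, Nat.even_iff, Nat.even_iff, Nat.ModEq]
    lia
  have hsign : (-1 : ℂ) ^ m * (-1 : ℂ) ^ G.signCount M =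
      if ¬ m ≡ G.signCount M [MOD 2] then -1 else 1 := by
    rw [← pow_add, neg_one_pow_eq_ite, ite_not, if_congr hparity rfl rfl]
  rw [postState_of_expectation_eq_zero G.star_state_dotProduct_state
    (star_state_dotProduct_toOp_mulVec_state hZ hG (Finset.ne_empty_of_mem hp)),
    toOp_mulVec_state hZ hG, smul_smul, hsign]
  exact G.sameState_collapse hp hsolid _

end StabilizerGraph

theorem mainTheorem2 {V : Type*} [Fintype V] [DecidableEq V] (G : StabilizerGraph V)
    (M : PauliProduct V) (hZ : M.IsZType) (hG : G.IsSimplifiedFor M) :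
    -- the outcome is `(-1)^b` with certainty exactly when `MSE` is empty
    (outcomeProb M.toOp G.state (G.signCount M) = 1 ↔ G.MSE M = ∅) ∧
    -- and in that case the state is unchanged
    (G.MSE M = ∅ →
      outcomeProb M.toOp G.state (G.signCount M + 1) = 0 ∧
      postState M.toOp G.state (G.signCount M) = G.state) ∧
    -- otherwise both outcomes `(-1)^m` have probability `1/2`, and for every choice of the chosen
    -- node the graph produced by the four steps represents the post-measurement state
    (G.MSE M ≠ ∅ → ∀ m : ℕ,
      outcomeProb M.toOp G.state m = 1 / 2 ∧
      ∀ p ∈ G.MSE M,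
        SameState (postState M.toOp G.state m) (G.measureGraph M p m).state) := by
  have hnorm := G.star_state_dotProduct_state
  have heigen := StabilizerGraph.toOp_mulVec_state_of_MSE_eq_empty hZ hG
  refine ⟨⟨fun hprob => ?_, fun hMSE => ?_⟩, fun hMSE => ⟨?_, ?_⟩, fun hMSE m => ⟨?_, ?_⟩⟩
  · by_contra hMSE
    have hhalf := StabilizerGraph.outcomeProb_state_of_MSE_ne_empty hZ hG hMSE (G.signCount M)
    norm_num [hprob] at hhalf
  · rw [outcomeProb_of_eigenvector hnorm (heigen hMSE), if_pos ⟨_, rfl⟩]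
  · rw [outcomeProb_of_eigenvector hnorm (heigen hMSE), if_neg (by grind)]
  · exact postState_of_eigenvector hnorm (heigen hMSE)
  · exact StabilizerGraph.outcomeProb_state_of_MSE_ne_empty hZ hG hMSE m
  · exact fun p hp => StabilizerGraph.sameState_postState_measureGraph hZ hG hp m
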